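/- Let $\Gamma$ be a simple graph (finite or infinite), and let $A(\Gamma)$ be the right-angled Artin group it defines, i.e. the group generated by the vertices of $\Gamma$ subject to the relations $[u,v]=1$ for all pairs of adjacent vertices $u,v$. Let $m\le n$ be non-negative integers, let $\Lambda$ be a complete subgraph of $\Gamma$ with exactly $m$ vertices, and let $\langle\Lambda\rangle$ be the subgroup of $A(\Gamma)$ generated by the vertices of $\Lambda$. If there is an abelian subgroup $B\le A(\Gamma)$ of rank $n$ (that is, the maximal number of $\mathbb{Z}$-linearly independent elements of $B$ is $n$) such that $\langle\Lambda\rangle$ is virtually contained in $B$ (that is, some finite-index subgroup of $\langle\Lambda\rangle$ is contained in $B$), then $\Lambda$ is contained in a complete subgraph of $\Gamma$ with exactly $n$ vertices. -/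

import Mathlib

open scoped commutatorElement IsMulCommutative

/-- The right-angled Artin group `A(Γ)`: generated by the vertices of `Γ`, with the relation
`[u, v] = 1` whenever `u` and `v` are adjacent in `Γ`. -/
abbrev RAAG {V : Type*} (Γ : SimpleGraph V) : Type _ :=
  PresentedGroup {r : FreeGroup V | ∃ u v : V, Γ.Adj u v ∧ r = ⁅FreeGroup.of u, FreeGroup.of v⁆}

namespace RAAG

/-- The generator of `A(Γ)` given by the vertex `v`. -/
def gen {V : Type*} (Γ : SimpleGraph V) (v : V) : RAAG Γ := PresentedGroup.of v

/-- The special subgroup `⟨Λ⟩` of `A(Γ)`, generated by a set `Λ` of vertices. -/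
def special {V : Type*} (Γ : SimpleGraph V) (Λ : Set V) : Subgroup (RAAG Γ) :=
  Subgroup.closure (gen Γ '' Λ)

end RAAG

/-- `H` is virtually contained in `K`: some finite-index subgroup of `H` is contained in `K`. -/
def VirtuallyContained {G : Type*} [Group G] (H K : Subgroup G) : Prop :=
  ∃ F : Subgroup H, F.FiniteIndex ∧ F.map H.subtype ≤ K

/-! Killing a vertex `v` retracts A(Γ) onto the special subgroup of the other vertices, and the
kernel is free: `split` embeds A(Γ) in a semidirect product F ⋊ A(Γ), where F is free on the cosets
of the link subgroup L of `v`, sends `v` to the letter L, and maps the kernel into F. An abelian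
group meets the kernel in a cyclic group, so its rank drops by at most one
(`finrank_ker_retract_le`).

If the kernel contains a nontrivial image w of the abelian group, elements commuting with w permute
the letters and preserve the conjugacy class of w. Some letter gL is periodic under all such
permutations (`exists_forall_pow_apply_eq`), so up to multiples the projected group lies in gLg⁻¹.
Conjugating it into L and inducting gives a clique in the link, to which `v` is added. If there is
no such w, `v` can be discarded.

For a vertex `v` of Λ, some positive power of `v` lies in the abelian group, hence commutes with it.
This forces the projection into L itself, without conjugation, so the hypothesis on the rest of Λ
survives the induction.

Maps φ from a finitely generated abelian group replace subgroups; the rank of the image is that of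
the source minus that of the kernel. -/

namespace FreeGroup

/-! ### Commutative subgroups of free groups -/

theorem subsingleton_of_forall_commute {ι : Type*} (h : ∀ a b : FreeGroup ι, a * b = b * a) :
    Subsingleton ι := by
  classical
  refine ⟨fun a b => ?_⟩
  have := congrArg toWord (h (of a) (of b))
  simp only [toWord_mul, toWord_of] at this
  exact (show a = b ∧ b = a by simpa using this).1

/-- A commutative subgroup of a free group consists of the powers of one of its elements. -/
theorem exists_zpow_eq_of_commute {X : Type*} (C : Subgroup (FreeGroup X))
    (hC : ∀ a ∈ C, ∀ b ∈ C, a * b = b * a) : ∃ c ∈ C, ∀ a ∈ C, ∃ k : ℤ, c ^ k = a := by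
  let e := IsFreeGroup.toFreeGroup C
  have hs : Subsingleton (IsFreeGroup.Generators C) := by
    apply subsingleton_of_forall_commute
    intro a b
    apply e.symm.injective
    simp only [_root_.map_mul]
    exact Subtype.ext (hC _ (e.symm a).2 _ (e.symm b).2)
  have hcyc : IsCyclic (FreeGroup (IsFreeGroup.Generators C)) := by
    rcases isEmpty_or_nonempty (IsFreeGroup.Generators C) with h | ⟨⟨x⟩⟩
    · infer_instance
    · have := uniqueOfSubsingleton x
      infer_instance
  obtain ⟨c, hc⟩ := hcyc
  refine ⟨e.symm c, (e.symm c).2, fun a ha => ?_⟩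
  obtain ⟨k, hk⟩ := hc (e ⟨a, ha⟩)
  refine ⟨k, ?_⟩
  have : e.symm c ^ k = ⟨a, ha⟩ := by
    rw [← map_zpow]
    exact e.symm_apply_eq.2 hk
  exact congrArg Subtype.val this

/-! ### Letters in powers of a word, and periodic letters -/

/-- The number of occurrences of the letter `x`, with either sign, in the reduced word of `g`. -/
def letterCount {X : Type*} [DecidableEq X] (x : X) (g : FreeGroup X) : ℕ :=
  (g.toWord.map Prod.fst).count x

section letterCount

variable {X : Type*} [DecidableEq X] (x : X)

theorem letterCount_one : letterCount x 1 = 0 := by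
  simp [letterCount]

theorem letterCount_mk_le (L : List (X × Bool)) :
    letterCount x (mk L) ≤ (L.map Prod.fst).count x := by
  rw [letterCount, toWord_mk]
  exact ((reduce.red (L := L)).sublist.map Prod.fst).count_le x

theorem letterCount_mul_le (g h : FreeGroup X) :
    letterCount x (g * h) ≤ letterCount x g + letterCount x h := by
  have := ((toWord_mul_sublist g h).map Prod.fst).count_le x
  rw [List.map_append, List.count_append] at this
  exact this

theorem letterCount_pow_eq_zero {g : FreeGroup X} (h : letterCount x g = 0) (n : ℕ) :
    letterCount x (g ^ n) = 0 := by
  induction n with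
  | zero => simpa using letterCount_one x
  | succ n ih =>
    rw [pow_succ]
    have := letterCount_mul_le x (g ^ n) g
    omega

theorem letterCount_map_le (e : Equiv.Perm X) (y : X) (g : FreeGroup X) :
    letterCount y (map e g) ≤ letterCount (e.symm y) g := by
  conv_lhs => rw [← mk_toWord (x := g), map.mk]
  refine (letterCount_mk_le y _).trans (le_of_eq ?_)
  rw [letterCount, List.map_map]
  have : (Prod.fst ∘ fun p : X × Bool => (e p.1, p.2)) = e ∘ Prod.fst := rfl
  rw [this, ← List.map_map]
  conv_lhs => rw [← e.apply_symm_apply y]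
  exact List.count_map_of_injective _ e e.injective _

end letterCount

/-- The letters that occur unboundedly often in the reduced words of the powers of `w`. -/
def recurrentLetters {X : Type*} [DecidableEq X] (w : FreeGroup X) : Set X :=
  {x | ∀ C, ∃ n, C < letterCount x (w ^ n)}

variable {X : Type*} [DecidableEq X]

/-- A letter absent from the reduced word of `w` is absent from those of all its powers. -/
theorem finite_recurrentLetters (w : FreeGroup X) : (recurrentLetters w).Finite := by
  refine (w.toWord.map Prod.fst).toFinset.finite_toSet.subset fun x hx => ?_
  by_contra hx'
  obtain ⟨n, hn⟩ := hx 0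
  rw [letterCount_pow_eq_zero] at hn
  · exact hn.false
  · exact List.count_eq_zero.2 (by simpa using hx')

/-- Each letter of the cyclic reduction of `w` recurs: the reduced word of a positive power of `w`
repeats this nonempty core between a conjugator and its inverse. -/
theorem recurrentLetters_nonempty {w : FreeGroup X} (hw : w ≠ 1) :
    (recurrentLetters w).Nonempty := by
  have hne : reduceCyclically w.toWord ≠ [] := by
    intro h
    have := congrArg mk (reduceCyclically.conj_conjugator_reduceCyclically w.toWord)
    rw [h, mk_toWord, List.append_nil, ← mul_mk, ← inv_mk, mul_inv_cancel] at this
    exact hw this.symm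
  obtain ⟨p, hp⟩ := List.exists_mem_of_ne_nil _ hne
  refine ⟨p.1, fun C => ⟨C + 1, ?_⟩⟩
  have hpos : 0 < ((reduceCyclically w.toWord).map Prod.fst).count p.1 :=
    List.count_pos_iff.2 (List.mem_map_of_mem hp)
  rw [letterCount, toWord_pow, reduceCyclically.reduce_flatten_replicate_succ isReduced_toWord,
    List.map_append, List.map_append, List.count_append, List.count_append, List.map_flatten,
    List.map_replicate, List.count_flatten, List.map_replicate, List.sum_replicate, smul_eq_mul]
  have : (C + 1) * 1 ≤ (C + 1) * ((reduceCyclically w.toWord).map Prod.fst).count p.1 :=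
    Nat.mul_le_mul_left _ hpos
  omega

/-- Conjugation by `g` changes the letter counts of all powers by an amount bounded in terms of `g`
alone. -/
theorem recurrentLetters_subset_conj (g w : FreeGroup X) :
    recurrentLetters w ⊆ recurrentLetters (g * w * g⁻¹) := by
  intro x hx C
  obtain ⟨n, hn⟩ := hx (letterCount x g⁻¹ + C + letterCount x g)
  refine ⟨n, ?_⟩
  have h1 := letterCount_mul_le x (g⁻¹ * (g * w * g⁻¹) ^ n) g
  have h2 := letterCount_mul_le x g⁻¹ ((g * w * g⁻¹) ^ n)
  have : g⁻¹ * (g * w * g⁻¹) ^ n * g = w ^ n := by rw [conj_pow]; group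
  rw [this] at h1
  omega

theorem symm_mem_recurrentLetters (e : Equiv.Perm X) {w : FreeGroup X} (he : IsConj (map e w) w)
    {x : X} (hx : x ∈ recurrentLetters w) : e.symm x ∈ recurrentLetters w := by
  obtain ⟨g, hg⟩ := isConj_iff.1 he.symm
  have h := recurrentLetters_subset_conj g w hx
  rw [hg] at h
  intro C
  obtain ⟨n, hn⟩ := h C
  refine ⟨n, hn.trans_le ?_⟩
  rw [← _root_.map_pow]
  exact letterCount_map_le e x _

/-- A letter of `w` is periodic under all permutations of the letters that preserve the conjugacy
class of `w`. -/
theorem exists_forall_pow_apply_eq {X : Type*} {w : FreeGroup X} (hw : w ≠ 1) :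
    ∃ x, ∀ e : Equiv.Perm X, IsConj (map e w) w → ∃ k : ℕ, k ≠ 0 ∧ (e ^ k) x = x := by
  classical
  obtain ⟨x, hx⟩ := recurrentLetters_nonempty hw
  refine ⟨x, fun e he => ?_⟩
  have hmem : ∀ k : ℕ, (e⁻¹ ^ k) x ∈ recurrentLetters w := by
    intro k
    induction k with
    | zero => simpa using hx
    | succ k ih =>
      rw [pow_succ', Equiv.Perm.mul_apply]
      exact symm_mem_recurrentLetters e he ih
  -- The backward orbit of `x` stays in a finite set, so it repeats.
  obtain ⟨i, j, hij, h⟩ :=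
    Set.Finite.exists_lt_map_eq_of_forall_mem hmem (finite_recurrentLetters w)
  refine ⟨j - i, by omega, ?_⟩
  have hj : j = i + (j - i) := by omega
  rw [hj, pow_add, Equiv.Perm.mul_apply] at h
  have h' := (e⁻¹ ^ i).injective h
  conv_lhs => rw [h']
  rw [← Equiv.Perm.mul_apply, inv_pow, mul_inv_cancel, Equiv.Perm.one_apply]

end FreeGroup

/-! ### Ranks of finitely generated abelian groups -/

section Rank

variable {M : Type*} [AddCommGroup M] [Module.Finite ℤ M]

theorem AddSubgroup.finrank_mono {N P : AddSubgroup M} (h : N ≤ P) :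
    Module.finrank ℤ N ≤ Module.finrank ℤ P :=
  Submodule.finrank_mono (s := N.toIntSubmodule) (t := P.toIntSubmodule) h

theorem AddSubgroup.finrank_le_add_one {N P : AddSubgroup M} (c : M)
    (h : ∀ m ∈ N, ∃ k : ℤ, m - k • c ∈ P) : Module.finrank ℤ N ≤ Module.finrank ℤ P + 1 := by
  let P' := P.toIntSubmodule
  have hN : N.toIntSubmodule ≤ P' ⊔ Submodule.span ℤ {c} := by
    intro m hm
    obtain ⟨k, hk⟩ := h m hm
    exact Submodule.mem_sup.2 ⟨m - k • c, hk, k • c,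
      Submodule.smul_mem _ _ (Submodule.mem_span_singleton_self c), by simp⟩
  have h1 := Submodule.finrank_mono hN
  have h2 : Module.finrank ℤ (P' ⊔ Submodule.span ℤ {c} : Submodule ℤ M) ≤
      Module.finrank ℤ P' + Module.finrank ℤ (Submodule.span ℤ {c}) := by
    have := Submodule.rank_add_le_rank_add_rank P' (Submodule.span ℤ {c})
    simp only [← Module.finrank_eq_rank] at this
    exact_mod_cast this
  have h3 : Module.finrank ℤ (Submodule.span ℤ {c}) ≤ 1 := by
    simpa using finrank_span_le_card (R := ℤ) ({c} : Set M)
  exact h1.trans (h2.trans (Nat.add_le_add_left h3 _))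

/-- The quotient is torsion, hence of rank zero. -/
theorem AddSubgroup.finrank_eq_of_forall_nsmul_mem (N : AddSubgroup M)
    (h : ∀ m, ∃ k : ℕ, k ≠ 0 ∧ k • m ∈ N) : Module.finrank ℤ N = Module.finrank ℤ M := by
  let N' := N.toIntSubmodule
  have h1 : Module.finrank ℤ (M ⧸ N') = 0 := by
    rw [Module.finrank_eq_zero_iff_isTorsion]
    rintro ⟨m⟩
    obtain ⟨k, hk, hm⟩ := h m
    refine ⟨⟨(k : ℤ), mem_nonZeroDivisors_of_ne_zero (by exact_mod_cast hk)⟩, ?_⟩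
    refine (Submodule.Quotient.mk_eq_zero N' (x := (k : ℤ) • m)).2 ?_
    rw [natCast_zsmul]
    exact hm
  have h2 := Submodule.finrank_quotient_add_finrank N'
  rw [h1, zero_add] at h2
  exact h2

end Rank

/-! ### Special subgroups and retractions -/

namespace RAAG

variable {V : Type*} (Γ : SimpleGraph V)

theorem commute_gen {u v : V} (h : Γ.Adj u v) : Commute (gen Γ u) (gen Γ v) := by
  rw [← commutatorElement_eq_one_iff_commute]
  exact PresentedGroup.one_of_mem (x := ⁅FreeGroup.of u, FreeGroup.of v⁆) ⟨u, v, h, rfl⟩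

variable {Γ} in
/-- A map on the vertices that sends adjacent vertices to commuting elements extends to `A(Γ)`. -/
def lift {G : Type*} [Group G] (f : V → G) (hf : ∀ u v, Γ.Adj u v → Commute (f u) (f v)) :
    RAAG Γ →* G :=
  PresentedGroup.toGroup (f := f) (by
    rintro r ⟨u, v, h, rfl⟩
    rw [map_commutatorElement, FreeGroup.lift_apply_of, FreeGroup.lift_apply_of,
      commutatorElement_eq_one_iff_commute]
    exact hf u v h)

@[simp]
theorem lift_gen {G : Type*} [Group G] (f : V → G)
    (hf : ∀ u v, Γ.Adj u v → Commute (f u) (f v)) (v : V) : lift f hf (gen Γ v) = f v :=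
  PresentedGroup.toGroup.of _

variable {Γ} in
theorem hom_ext {G : Type*} [Group G] {f g : RAAG Γ →* G}
    (h : ∀ v, f (gen Γ v) = g (gen Γ v)) : f = g :=
  PresentedGroup.ext h

theorem gen_mem_special {S : Set V} {v : V} (hv : v ∈ S) : gen Γ v ∈ special Γ S :=
  Subgroup.subset_closure ⟨v, hv, rfl⟩

theorem special_mono {S T : Set V} (h : S ⊆ T) : special Γ S ≤ special Γ T :=
  Subgroup.closure_mono (Set.image_mono h)

theorem special_univ : special Γ Set.univ = ⊤ := by
  rw [special, Set.image_univ]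
  exact PresentedGroup.closure_range_of _

theorem special_empty : special Γ ∅ = ⊥ := by
  simp [special]

/-- Every element of `A(Γ)` involves only finitely many generators. -/
theorem exists_finset_mem_special [DecidableEq V] (g : RAAG Γ) :
    ∃ s : Finset V, g ∈ special Γ (s : Set V) := by
  have hg : g ∈ special Γ Set.univ := by simp [special_univ]
  induction hg using Subgroup.closure_induction with
  | mem x hx =>
    obtain ⟨v, -, rfl⟩ := hx
    exact ⟨{v}, gen_mem_special Γ (by simp)⟩
  | one => exact ⟨∅, one_mem _⟩
  | mul x y _ _ hx hy =>
    obtain ⟨s, hs⟩ := hx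
    obtain ⟨t, ht⟩ := hy
    exact ⟨s ∪ t, mul_mem (special_mono Γ (by simp) hs) (special_mono Γ (by simp) ht)⟩
  | inv x _ hx =>
    obtain ⟨s, hs⟩ := hx
    exact ⟨s, inv_mem hs⟩

open scoped Classical in
/-- The endomorphism of `A(Γ)` that kills the generators outside `S`. -/
noncomputable def retract (S : Set V) : RAAG Γ →* RAAG Γ :=
  lift (fun v => if v ∈ S then gen Γ v else 1) (by
    intro u v h
    split_ifs
    · exact commute_gen Γ h
    all_goals simp)

theorem retract_gen_of_mem {S : Set V} {v : V} (hv : v ∈ S) :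
    retract Γ S (gen Γ v) = gen Γ v := by
  simp [retract, hv]

theorem retract_gen_of_notMem {S : Set V} {v : V} (hv : v ∉ S) : retract Γ S (gen Γ v) = 1 := by
  simp [retract, hv]

theorem retract_eq_self {S : Set V} {g : RAAG Γ} (hg : g ∈ special Γ S) : retract Γ S g = g := by
  have : special Γ S ≤ (retract Γ S).eqLocus (MonoidHom.id _) := by
    rw [special, Subgroup.closure_le]
    rintro _ ⟨v, hv, rfl⟩
    exact retract_gen_of_mem Γ hv
  exact this hg

theorem retract_mem_special_inter (S : Set V) {T : Set V} {g : RAAG Γ} (hg : g ∈ special Γ T) :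
    retract Γ S g ∈ special Γ (T ∩ S) := by
  have : special Γ T ≤ (special Γ (T ∩ S)).comap (retract Γ S) := by
    rw [special, Subgroup.closure_le]
    rintro _ ⟨v, hv, rfl⟩
    by_cases h : v ∈ S
    · simpa [retract_gen_of_mem Γ h] using gen_mem_special Γ (S := T ∩ S) ⟨hv, h⟩
    · simp [retract_gen_of_notMem Γ h]
  exact this hg

/-! ### Splitting off a vertex -/

section Splitting

variable (v : V)

/-- The special subgroup generated by the neighbors of `v`. -/
abbrev linkSubgroup : Subgroup (RAAG Γ) := special Γ (Γ.neighborSet v)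

theorem commute_gen_of_mem_linkSubgroup {g : RAAG Γ} (hg : g ∈ linkSubgroup Γ v) :
    Commute g (gen Γ v) := by
  have : linkSubgroup Γ v ≤ Subgroup.centralizer {gen Γ v} := by
    rw [linkSubgroup, special, Subgroup.closure_le]
    rintro _ ⟨u, hu, rfl⟩
    rw [SetLike.mem_coe, Subgroup.mem_centralizer_singleton_iff]
    exact (commute_gen Γ hu).symm.eq
  exact Subgroup.mem_centralizer_singleton_iff.1 (this hg)

/-- The action on the free group on a `G`-set by permutation of the letters. -/
def freeGroupAction (G X : Type*) [Group G] [MulAction G X] : G →* MulAut (FreeGroup X) where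
  toFun g := FreeGroup.freeGroupCongr (MulAction.toPerm g)
  map_one' := by
    ext x
    induction x using FreeGroup.induction_on <;> simp_all
  map_mul' g h := by
    ext x
    induction x using FreeGroup.induction_on <;> simp_all [mul_smul]

theorem freeGroupAction_apply {G X : Type*} [Group G] [MulAction G X] (g : G) (w : FreeGroup X) :
    freeGroupAction G X g w = FreeGroup.map (MulAction.toPerm g) w := rfl

/-- The semidirect product of `A(Γ)` with the free group on the cosets of the link subgroup. -/
abbrev LinkSemidirect : Type _ :=
  FreeGroup (RAAG Γ ⧸ linkSubgroup Γ v) ⋊[freeGroupAction (RAAG Γ) (RAAG Γ ⧸ linkSubgroup Γ v)]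
    RAAG Γ

/-- The letter given by the trivial coset of the link subgroup. -/
abbrev baseLetter : RAAG Γ ⧸ linkSubgroup Γ v := ((1 : RAAG Γ) : RAAG Γ ⧸ linkSubgroup Γ v)

/-- A neighbor of `v` lies in the link subgroup, so it fixes the trivial coset. -/
theorem commute_inl_inr {u : V} (h : Γ.Adj v u) :
    Commute (SemidirectProduct.inl (FreeGroup.of (baseLetter Γ v)) : LinkSemidirect Γ v)
      (SemidirectProduct.inr (gen Γ u)) := by
  have hu : gen Γ u • baseLetter Γ v = baseLetter Γ v := by
    rw [MulAction.Quotient.smul_coe]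
    refine QuotientGroup.eq.2 ?_
    simpa using gen_mem_special Γ (S := Γ.neighborSet v) h
  ext
  · simp [freeGroupAction_apply, hu]
  · simp

open scoped Classical in
/-- The embedding that sends `v` to the base letter and the other vertices to themselves. -/
noncomputable def split : RAAG Γ →* LinkSemidirect Γ v :=
  lift (fun u => if u = v then SemidirectProduct.inl (FreeGroup.of (baseLetter Γ v))
    else SemidirectProduct.inr (gen Γ u)) (by
    intro a b h
    split_ifs with ha hb hb
    · exact Commute.refl _
    · subst ha
      exact commute_inl_inr Γ a h
    · subst hb
      exact (commute_inl_inr Γ b h.symm).symm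
    · exact (commute_gen Γ h).map SemidirectProduct.inr)

theorem split_gen_self :
    split Γ v (gen Γ v) = SemidirectProduct.inl (FreeGroup.of (baseLetter Γ v)) := by
  simp [split]

theorem split_gen_of_ne {u : V} (h : u ≠ v) :
    split Γ v (gen Γ u) = SemidirectProduct.inr (gen Γ u) := by
  simp [split, h]

/-- The conjugate of `v` given by a coset of the link subgroup. -/
def cosetConj : RAAG Γ ⧸ linkSubgroup Γ v → RAAG Γ :=
  Quotient.lift (fun g => g * gen Γ v * g⁻¹) (by
    intro a b h
    have h' := (commute_gen_of_mem_linkSubgroup Γ v (QuotientGroup.leftRel_apply.1 h)).eq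
    calc a * gen Γ v * a⁻¹ = a * (a⁻¹ * b * gen Γ v * (a⁻¹ * b)⁻¹) * a⁻¹ := by
          rw [h', mul_inv_cancel_right]
      _ = b * gen Γ v * b⁻¹ := by group)

theorem cosetConj_mk (g : RAAG Γ) :
    cosetConj Γ v (g : RAAG Γ ⧸ linkSubgroup Γ v) = g * gen Γ v * g⁻¹ := rfl

/-- A left inverse of `RAAG.split`. -/
def unsplit : LinkSemidirect Γ v →* RAAG Γ :=
  SemidirectProduct.lift (FreeGroup.lift (cosetConj Γ v)) (MonoidHom.id _) (by
    intro g
    refine FreeGroup.ext_hom _ _ fun x => ?_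
    induction x using QuotientGroup.induction_on with
    | H a =>
      simp [freeGroupAction_apply, cosetConj_mk, mul_assoc])

theorem unsplit_split (g : RAAG Γ) : unsplit Γ v (split Γ v g) = g := by
  have : (unsplit Γ v).comp (split Γ v) = MonoidHom.id _ := by
    refine hom_ext fun u => ?_
    by_cases h : u = v
    · subst h
      simp [split_gen_self, unsplit, cosetConj_mk]
    · simp [split_gen_of_ne Γ v h, unsplit]
  exact DFunLike.congr_fun this g

theorem split_injective : Function.Injective (split Γ v) :=
  Function.LeftInverse.injective (unsplit_split Γ v)

/-- The right component of `RAAG.split`, which kills `v` and fixes the other vertices. -/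
theorem right_split (g : RAAG Γ) : (split Γ v g).right = retract Γ {v}ᶜ g := by
  have : SemidirectProduct.rightHom.comp (split Γ v) = retract Γ {v}ᶜ := by
    refine hom_ext fun u => ?_
    by_cases h : u = v
    · subst h
      simp [split_gen_self, retract_gen_of_notMem]
    · simp [split_gen_of_ne Γ v h, retract_gen_of_mem Γ (S := {v}ᶜ) h]
  exact DFunLike.congr_fun this g

/-- The kernel of the retraction that kills `v` is a free group. -/
theorem split_eq_inl {g : RAAG Γ} (hg : retract Γ {v}ᶜ g = 1) :
    split Γ v g = SemidirectProduct.inl (split Γ v g).left := by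
  ext
  · rfl
  · rw [right_split, hg, SemidirectProduct.right_inl]

/-- The letters are permuted by `A(Γ)` so that commuting elements preserve conjugacy classes. -/
theorem isConj_of_commute {g k : RAAG Γ} {w : FreeGroup (RAAG Γ ⧸ linkSubgroup Γ v)}
    (hk : split Γ v k = SemidirectProduct.inl w) (h : Commute g k) :
    IsConj (FreeGroup.map (MulAction.toPerm (retract Γ {v}ᶜ g)) w) w := by
  -- The left components of gk = kg exhibit the conjugation: with a the left component of g, they
  -- read a · (g acting on w) = w · a.
  have := congrArg SemidirectProduct.left (h.map (split Γ v)).eq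
  rw [hk, SemidirectProduct.mul_left, SemidirectProduct.mul_left, SemidirectProduct.right_inl,
    map_one, right_split, SemidirectProduct.left_inl, MulAut.one_apply,
    freeGroupAction_apply] at this
  exact isConj_iff.2 ⟨_, mul_inv_eq_of_eq_mul this⟩

/-- An element that commutes with a nontrivial power of `v` projects into the link subgroup. -/
theorem retract_mem_linkSubgroup {g : RAAG Γ} {k : ℕ} (hk : k ≠ 0)
    (h : Commute g (gen Γ v ^ k)) : retract Γ {v}ᶜ g ∈ linkSubgroup Γ v := by
  classical
  have hc := isConj_of_commute Γ v (w := FreeGroup.of (baseLetter Γ v) ^ k)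
    (by rw [map_pow, split_gen_self, map_pow]) h
  -- The exponent sum of the base letter is a conjugacy invariant. It is `k` on the original power
  -- and would be 0 if the letter were moved.
  have hc' := MonoidHom.map_isConj (FreeGroup.lift fun x =>
    if x = baseLetter Γ v then Multiplicative.ofAdd (1 : ℤ) else 1) hc
  rw [isConj_iff_eq] at hc'
  have hfix : (retract Γ {v}ᶜ g : RAAG Γ ⧸ linkSubgroup Γ v) = baseLetter Γ v := by
    by_contra hne
    have : (1 : Multiplicative ℤ) = Multiplicative.ofAdd (1 : ℤ) ^ k := by
      simpa [hne] using hc'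
    have := congrArg Multiplicative.toAdd this
    exact hk (by simpa using this.symm)
  have := QuotientGroup.eq.1 hfix.symm
  simpa using this

end Splitting

end RAAG

/-! ### Cliques from abelian subgroups -/

namespace RAAG

variable {V : Type*} (Γ : SimpleGraph V) {M : Type*} [AddCommGroup M]

open Additive in
theorem commute_toMul {G : Type*} [Group G] (φ : M →+ Additive G) (a b : M) :
    Commute (toMul (φ a)) (toMul (φ b)) := by
  rw [commute_iff_eq, ← toMul_add, ← toMul_add, ← map_add, ← map_add, add_comm]

/-- Killing a vertex lowers the rank of an abelian subgroup by at most one. -/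
theorem finrank_ker_retract_le [Module.Finite ℤ M] (v : V) (φ : M →+ Additive (RAAG Γ)) :
    Module.finrank ℤ ((retract Γ {v}ᶜ).toAdditive.comp φ).ker ≤ Module.finrank ℤ φ.ker + 1 := by
  -- The part of the abelian image that lies in the free kernel; it is generated by the image of a
  -- single `m₀`.
  let C : Subgroup (FreeGroup (RAAG Γ ⧸ linkSubgroup Γ v)) :=
    { carrier := {f | ∃ m, split Γ v (φ m).toMul = SemidirectProduct.inl f}
      one_mem' := ⟨0, by simp⟩
      mul_mem' := by
        rintro a b ⟨m, hm⟩ ⟨m', hm'⟩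
        exact ⟨m + m', by rw [map_add, toMul_add, map_mul, hm, hm', map_mul]⟩
      inv_mem' := by
        rintro a ⟨m, hm⟩
        exact ⟨-m, by rw [map_neg, toMul_neg, map_inv, hm, map_inv]⟩ }
  obtain ⟨c, ⟨m₀, hm₀⟩, hc⟩ := FreeGroup.exists_zpow_eq_of_commute C (by
    rintro a ⟨m, hm⟩ b ⟨m', hm'⟩
    apply SemidirectProduct.inl_injective
      (φ := freeGroupAction (RAAG Γ) (RAAG Γ ⧸ linkSubgroup Γ v))
    rw [map_mul, map_mul, ← hm, ← hm']
    exact ((commute_toMul φ m m').map (split Γ v)).eq)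
  refine AddSubgroup.finrank_le_add_one m₀ fun m hm => ?_
  have hm' : split Γ v (φ m).toMul = SemidirectProduct.inl (split Γ v (φ m).toMul).left :=
    split_eq_inl Γ v (Additive.toMul.injective hm)
  obtain ⟨k, hk⟩ := hc _ ⟨m, hm'⟩
  refine ⟨k, ?_⟩
  rw [AddMonoidHom.mem_ker, map_sub, sub_eq_zero, map_zsmul]
  apply Additive.toMul.injective
  apply split_injective Γ v
  rw [hm', ← hk, map_zpow, ← hm₀, toMul_zsmul, map_zpow]

/-- A graph whose right-angled Artin group contains an abelian subgroup of rank at least `n`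
contains a complete subgraph with `n` vertices. -/
theorem exists_isNClique_of_finrank (t : Finset V) (n : ℕ) [Module.Finite ℤ M]
    (φ : M →+ Additive (RAAG Γ)) (hφ : ∀ m, (φ m).toMul ∈ special Γ (t : Set V))
    (hn : n + Module.finrank ℤ φ.ker ≤ Module.finrank ℤ M) :
    ∃ Ξ ⊆ t, Γ.IsNClique n Ξ := by
  classical
  induction t using Finset.strongInduction generalizing n M with
  | H t ih =>
  rcases n with _ | n
  · exact ⟨∅, by simp, by simp⟩
  obtain rfl | ⟨v, hv⟩ := t.eq_empty_or_nonempty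
  · have hker : φ.ker = ⊤ := by
      refine eq_top_iff.2 fun m _ => Additive.toMul.injective ?_
      simpa [special_empty] using hφ m
    have h := (AddSubgroup.finrank_eq_of_forall_nsmul_mem φ.ker
      fun m => ⟨1, one_ne_zero, by simp [hker]⟩)
    omega
  let ψ := (retract Γ {v}ᶜ).toAdditive.comp φ
  have hψ : ∀ m, (ψ m).toMul = retract Γ {v}ᶜ (φ m).toMul := fun _ => rfl
  have hψmem : ∀ m, (ψ m).toMul ∈ special Γ (t.erase v : Set V) := by
    intro m
    rw [Finset.coe_erase, Set.sdiff_eq]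
    exact retract_mem_special_inter Γ _ (hφ m)
  -- If killing `v` loses no rank, `v` is dropped from `t`; otherwise some `m₀` has a nontrivial
  -- image in the free kernel.
  by_cases hker : ψ.ker ≤ φ.ker
  · obtain ⟨Ξ, hΞ, hc⟩ := ih _ (Finset.erase_ssubset hv) (n + 1) ψ hψmem
      ((Nat.add_le_add_left (AddSubgroup.finrank_mono hker) _).trans hn)
    exact ⟨Ξ, hΞ.trans (Finset.erase_subset _ _), hc⟩
  obtain ⟨m₀, hm₀, hm₀'⟩ := SetLike.not_le_iff_exists.1 hker
  have hsplit := split_eq_inl Γ v (g := (φ m₀).toMul) (Additive.toMul.injective hm₀)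
  obtain ⟨x, hx⟩ := FreeGroup.exists_forall_pow_apply_eq (w := (split Γ v (φ m₀).toMul).left) (by
    intro h
    rw [h, map_one, ← map_one (split Γ v)] at hsplit
    exact hm₀' (Additive.toMul.injective (split_injective Γ v hsplit)))
  induction x using QuotientGroup.induction_on with
  | H g =>
  -- The elements whose projection fixes the letter gL. Periodicity of this letter puts a nonzero
  -- multiple of every element here, so no rank is lost.
  let M' : AddSubgroup M :=
    { carrier := {m | g⁻¹ * (ψ m).toMul * g ∈ linkSubgroup Γ v}
      zero_mem' := by simp
      add_mem' := by
        intro a b ha hb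
        have := (linkSubgroup Γ v).mul_mem ha hb
        rw [Set.mem_ofPred_eq, map_add, toMul_add]
        convert this using 1
        group
      neg_mem' := by
        intro a ha
        have := (linkSubgroup Γ v).inv_mem ha
        rw [Set.mem_ofPred_eq, map_neg, toMul_neg]
        convert this using 1
        group }
  have hM' : Module.finrank ℤ M' = Module.finrank ℤ M := by
    refine AddSubgroup.finrank_eq_of_forall_nsmul_mem M' fun m => ?_
    obtain ⟨k, hk, hfix⟩ := hx _ (isConj_of_commute Γ v hsplit (commute_toMul φ m m₀))
    refine ⟨k, hk, ?_⟩
    rw [← MulAction.toPermHom_apply, ← map_pow, ← hψ, ← toMul_nsmul, ← map_nsmul] at hfix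
    have := QuotientGroup.eq.1 hfix.symm
    change g⁻¹ * (ψ (k • m)).toMul * g ∈ linkSubgroup Γ v
    rw [mul_assoc]
    exact this
  -- Conjugation moves the stabilizer of gL into the link subgroup; since `g` may involve vertices
  -- outside `t`, the retraction onto `t` follows.
  let χ : RAAG Γ →* RAAG Γ := (retract Γ (t : Set V)).comp (MulAut.conj g⁻¹).toMonoidHom
  have hχ : ∀ a, χ a = (retract Γ t g)⁻¹ * retract Γ t a * retract Γ t g := by
    intro a
    simp [χ]
  let φ' : M' →+ Additive (RAAG Γ) := (χ.toAdditive.comp ψ).comp M'.subtype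
  have hφ' : ∀ m : M', (φ' m).toMul = χ (ψ m).toMul := fun _ => rfl
  have hφ'mem : ∀ m, (φ' m).toMul ∈ special Γ (t.filter (Γ.Adj v) : Set V) := by
    intro m
    have := retract_mem_special_inter Γ (t : Set V) m.2
    have he : (t.filter (Γ.Adj v) : Set V) = Γ.neighborSet v ∩ t := by
      ext u
      simp [and_comm]
    rw [he]
    simpa [hφ', χ] using this
  have hle : Module.finrank ℤ φ'.ker ≤ Module.finrank ℤ ψ.ker := by
    have hsub : φ'.ker.map M'.subtype ≤ ψ.ker := by
      rintro _ ⟨m, hm, rfl⟩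
      have h1 : χ (ψ m).toMul = 1 := Additive.toMul.injective hm
      -- The retraction fixes `ψ m`, so on these elements `χ` is conjugation by the retract of `g`
      -- and has no further kernel.
      rw [hχ, retract_eq_self Γ (special_mono Γ (by simp) (hψmem m)), mul_assoc,
        inv_mul_eq_one, eq_comm, mul_eq_right] at h1
      exact Additive.toMul.injective h1
    refine le_trans (le_of_eq ?_) (AddSubgroup.finrank_mono hsub)
    exact (φ'.ker.equivMapOfInjective M'.subtype
      Subtype.val_injective).toIntLinearEquiv.finrank_eq
  have hψle := finrank_ker_retract_le Γ v φ
  have hlt : t.filter (Γ.Adj v) ⊂ t :=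
    Finset.filter_ssubset.2 ⟨v, hv, by simp⟩
  have : Module.Finite ℤ M' := inferInstanceAs (Module.Finite ℤ M'.toIntSubmodule)
  obtain ⟨Ξ, hΞ, hc⟩ := ih _ hlt n φ' hφ'mem (by
    have : Module.finrank ℤ ψ.ker ≤ Module.finrank ℤ φ.ker + 1 := hψle
    omega)
  refine ⟨insert v Ξ, Finset.insert_subset hv (hΞ.trans (Finset.filter_subset _ _)), ?_⟩
  exact hc.insert fun u hu => (Finset.mem_filter.1 (hΞ hu)).2

/-- If an abelian subgroup of rank at least `n` centralizes nontrivial powers of the vertices of a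
complete subgraph `Λ` with at most `n` vertices, then `Λ` extends to a complete subgraph with `n`
vertices. -/
theorem exists_isNClique_of_commute_pow (Λ t : Finset V) (hΛt : Λ ⊆ t) (hΛ : Γ.IsClique Λ) (n : ℕ)
    (hn' : Λ.card ≤ n) [Module.Finite ℤ M]
    (φ : M →+ Additive (RAAG Γ)) (hφ : ∀ m, (φ m).toMul ∈ special Γ (t : Set V))
    (hcomm : ∀ v ∈ Λ, ∃ k : ℕ, k ≠ 0 ∧ ∀ m, Commute (φ m).toMul (gen Γ v ^ k))
    (hn : n + Module.finrank ℤ φ.ker ≤ Module.finrank ℤ M) :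
    ∃ Ξ ⊆ t, Λ ⊆ Ξ ∧ Γ.IsNClique n Ξ := by
  classical
  induction Λ using Finset.induction_on generalizing n t φ with
  | empty =>
    obtain ⟨Ξ, hΞ, hc⟩ := exists_isNClique_of_finrank Γ t n φ hφ hn
    exact ⟨Ξ, hΞ, by simp, hc⟩
  | insert v Λ hv ih =>
    rw [Finset.card_insert_of_notMem hv] at hn'
    obtain ⟨n, rfl⟩ := Nat.exists_eq_succ_of_ne_zero (Nat.ne_of_gt (Nat.zero_lt_of_lt hn'))
    rw [Finset.coe_insert, SimpleGraph.isClique_insert_of_notMem (by simpa using hv)] at hΛ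
    let ψ := (retract Γ {v}ᶜ).toAdditive.comp φ
    have hψ : ∀ m, (ψ m).toMul = retract Γ {v}ᶜ (φ m).toMul := fun _ => rfl
    have hψle : Module.finrank ℤ ψ.ker ≤ Module.finrank ℤ φ.ker + 1 :=
      finrank_ker_retract_le Γ v φ
    obtain ⟨k, hk, hkc⟩ := hcomm v (Finset.mem_insert_self _ _)
    -- The base letter itself is fixed, so neither a conjugation nor a smaller domain is needed, and
    -- the powers of the remaining vertices of Λ still commute with the projection.
    have hlink : ∀ m, (ψ m).toMul ∈ linkSubgroup Γ v := fun m =>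
      retract_mem_linkSubgroup Γ v hk (hkc m)
    obtain ⟨Ξ, hΞ, hΛΞ, hc⟩ := ih (t.filter (Γ.Adj v))
      (fun u hu => Finset.mem_filter.2 ⟨hΛt (Finset.mem_insert_of_mem hu), hΛ.2 u hu⟩)
      hΛ.1 n (by omega) ψ
      (fun m => by
        have he : (t.filter (Γ.Adj v) : Set V) = (t : Set V) ∩ {v}ᶜ ∩ Γ.neighborSet v := by
          ext u
          simp only [Finset.coe_filter, Set.mem_ofPred_eq, Set.mem_inter_iff, Finset.mem_coe,
            Set.mem_compl_iff, Set.mem_singleton_iff, SimpleGraph.mem_neighborSet]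
          exact ⟨fun h => ⟨⟨h.1, h.2.ne'⟩, h.2⟩, fun h => ⟨h.1.1, h.2⟩⟩
        rw [he, ← retract_eq_self Γ (hlink m)]
        exact retract_mem_special_inter Γ _ (retract_mem_special_inter Γ _ (hφ m)))
      (fun u hu => by
        obtain ⟨l, hl, hlc⟩ := hcomm u (Finset.mem_insert_of_mem hu)
        refine ⟨l, hl, fun m => ?_⟩
        have := (hlc m).map (retract Γ {v}ᶜ)
        rwa [map_pow, retract_gen_of_mem Γ (S := {v}ᶜ) (ne_of_mem_of_not_mem hu hv)] at this)
      (by omega)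
    refine ⟨insert v Ξ, Finset.insert_subset (hΛt (Finset.mem_insert_self _ _))
      (hΞ.trans (Finset.filter_subset _ _)), Finset.insert_subset_insert _ hΛΞ, ?_⟩
    exact hc.insert fun u hu => (Finset.mem_filter.1 (hΞ hu)).2

end RAAG

/-! ### Reduction to finitely many vertices -/

/-- A complete subgraph on `m` vertices is given by its vertex set, a clique with `m` elements.
The rank of an abelian group is its torsion-free rank, the rank as a `ℤ`-module. -/
theorem proposition2p1 {V : Type*} (Γ : SimpleGraph V) (m n : ℕ) (hmn : m ≤ n)
    (Λ : Finset V) (hΛ : Γ.IsNClique m Λ)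
    (A : Subgroup (RAAG Γ)) [IsMulCommutative A]
    (hA : Module.rank ℤ (Additive A) = (n : Cardinal))
    (hΛA : VirtuallyContained (RAAG.special Γ (Λ : Set V)) A) :
    ∃ Ξ : Finset V, Λ ⊆ Ξ ∧ Γ.IsNClique n Ξ := by
  classical
  obtain ⟨f, hf⟩ := Module.le_rank_iff_exists_linearMap.1 hA.ge
  let φ : (Fin n → ℤ) →+ Additive (RAAG Γ) := A.subtype.toAdditive.comp f.toAddMonoidHom
  have hφA : ∀ x, (φ x).toMul ∈ A := fun x => (f x).toMul.2
  have hker : φ.ker = ⊥ :=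
    (AddMonoidHom.ker_eq_bot_iff φ).2 (Subtype.val_injective.comp hf)
  -- The images of the n basis vectors involve finitely many vertices, so the induction can run on a
  -- finite set even if Γ is infinite.
  choose s hs using fun i : Fin n =>
    RAAG.exists_finset_mem_special Γ (φ (Pi.single i 1)).toMul
  let t := Λ ∪ Finset.univ.biUnion s
  have hφ : ∀ x, (φ x).toMul ∈ RAAG.special Γ (t : Set V) := by
    intro x
    have hx : x = ∑ i, x i • Pi.single i (1 : ℤ) := by
      simpa [← Pi.single_smul] using (Finset.univ_sum_single x).symm
    have hmem : x ∈ (RAAG.special Γ (t : Set V)).toAddSubgroup.comap φ := by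
      rw [hx]
      refine sum_mem fun i _ => zsmul_mem ?_ _
      refine RAAG.special_mono Γ ?_ (hs i)
      exact_mod_cast (Finset.subset_biUnion_of_mem s (Finset.mem_univ i)).trans
        Finset.subset_union_right
    exact hmem
  obtain ⟨F, hF, hFA⟩ := hΛA
  obtain ⟨Ξ, -, hΛΞ, hΞ⟩ := RAAG.exists_isNClique_of_commute_pow Γ Λ t
    Finset.subset_union_left hΛ.isClique n (hΛ.card_eq.trans_le hmn) φ hφ
    (fun v hv => by
      -- Finite index puts a positive power of each vertex of Λ in `A`, which is abelian.
      obtain ⟨k, hk, -, hkF⟩ := Subgroup.exists_pow_mem_of_index_ne_zero hF.index_ne_zero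
        ⟨RAAG.gen Γ v, RAAG.gen_mem_special Γ hv⟩
      refine ⟨k, hk.ne', fun x => ?_⟩
      have hkA : RAAG.gen Γ v ^ k ∈ A := hFA ⟨_, hkF, rfl⟩
      exact congrArg Subtype.val (mul_comm (⟨_, hφA x⟩ : A) ⟨_, hkA⟩))
    (by
      have : Subsingleton φ.ker := by
        rw [hker]
        infer_instance
      rw [Module.finrank_zero_of_subsingleton, Module.finrank_fin_fun, add_zero])
  exact ⟨Ξ, hΛΞ, hΞ⟩
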